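/- Let $d\ge 2$ be an integer and let $\mathcal M_k$ denote the algebra of complex $k\times k$ matrices. A quantum channel is a completely positive trace-preserving linear map between matrix algebras. Two quantum channels $\Phi:\mathcal M_d\to\mathcal M_m$ and $\Phi_c:\mathcal M_d\to\mathcal M_e$ are *complementary* to each other if there is an isometry $V:\mathbb C^d\to\mathbb C^m\otimes\mathbb C^e$ such that $\Phi(X)=\operatorname{Tr}_{\mathbb C^e}(VXV^\dagger)$ and $\Phi_c(X)=\operatorname{Tr}_{\mathbb C^m}(VXV^\dagger)$ for all $X\in\mathcal M_d$. Let $S(\rho)=-\operatorname{Tr}(\rho\log\rho)$ be the von Neumann entropy of a state (a positive semidefinite matrix of trace $1$). The coherent information of a channel $\Phi$ is $\mathcal Q^{(1)}(\Phi)=\max_\rho\,[S(\Phi(\rho))-S(\Phi_c(\rho))]$, where $\rho$ runs over the states and $\Phi_c$ is a channel complementary to $\Phi$ (the difference does not depend on its choice), and the quantum capacity of $\Phi$ is $$\mathcal Q(\Phi)=\lim_{n\to\infty}\frac{\mathcal Q^{(1)}(\Phi^{\otimes n})}{n}.$$ For $p\in\left[0,\frac{d^2}{d^2-1}\right]$ and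 $q\in\left[\frac{d}{d+1},\frac{d}{d-1}\right]$ let $\mathcal D_p,\mathcal D^\top_q:\mathcal M_d\to\mathcal M_d$ be the depolarizing and transpose-depolarizing channels $$\mathcal D_p(X)=(1-p)X+p\operatorname{Tr}(X)\frac{\mathbb 1_d}{d},\qquad \mathcal D^\top_q(X)=(1-q)X^\top+q\operatorname{Tr}(X)\frac{\mathbb 1_d}{d}.$$ Then: 1. if $p>0$, every channel $\Phi_c:\mathcal M_d\to\mathcal M_e$ (with any $e$) that is complementary to $\mathcal D_p$ has positive quantum capacity: the limit defining $\mathcal Q(\Phi_c)$ exists and $\mathcal Q(\Phi_c)>0$; 2. if $q<\frac{d}{d-1}$, every channel $\Phi_c:\mathcal M_d\to\mathcal M_e$ (with any $e$) that is complementary to $\mathcal D^\top_q$ has positive quantum capacity: the limit defining $\mathcal Q(\Phi_c)$ exists and $\mathcal Q(\Phi_c)>0$. -/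

import Mathlib

open Filter Topology
open scoped Matrix ComplexOrder

noncomputable section

namespace QuantumChannels

/-- The matrix algebra `M_a` of square complex matrices with rows and columns indexed by `a`. -/
abbrev Mat (a : Type) : Type := Matrix a a ℂ

/-- Quantum states: positive semidefinite matrices with unit trace. -/
def IsState {a : Type} [Fintype a] (ρ : Mat a) : Prop :=
  ρ.PosSemidef ∧ ρ.trace = 1

open Classical in
/-- The von Neumann entropy `S(ρ) = - Tr (ρ log ρ) = - ∑ λ log λ`, the sum running over the
eigenvalues of `ρ` with multiplicity and with `0 log 0 = 0` (natural logarithm). It is only used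
for states; the value on a non-Hermitian matrix is set to `0`. -/
def entropy {a : Type} [Fintype a] [DecidableEq a] (ρ : Mat a) : ℝ :=
  if h : ρ.IsHermitian then ∑ i, Real.negMulLog (h.eigenvalues i) else 0

/-- The map `id_r ⊗ Φ`, acting on `r`-by-`r` block matrices by applying `Φ` to every block. -/
def ampliate {a b : Type} (r : ℕ) (Φ : Mat a →ₗ[ℂ] Mat b) (X : Mat (Fin r × a)) :
    Mat (Fin r × b) :=
  Matrix.of fun s t => Φ (Matrix.of fun i j => X (s.1, i) (t.1, j)) s.2 t.2

/-- Complete positivity: `id_r ⊗ Φ` preserves positive semidefiniteness for every `r`. -/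
def IsCompletelyPositive {a b : Type} (Φ : Mat a →ₗ[ℂ] Mat b) : Prop :=
  ∀ (r : ℕ) (X : Mat (Fin r × a)), X.PosSemidef → (ampliate r Φ X).PosSemidef

/-- Quantum channels: completely positive and trace preserving linear maps. -/
def IsQuantumChannel {a b : Type} [Fintype a] [Fintype b] (Φ : Mat a →ₗ[ℂ] Mat b) : Prop :=
  IsCompletelyPositive Φ ∧ ∀ X, (Φ X).trace = X.trace

/-- The partial trace over the environment `E` of a matrix on `b ⊗ E`. -/
def traceEnv {b E : Type} [Fintype E] (M : Mat (b × E)) : Mat b :=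
  Matrix.of fun i j => ∑ k, M (i, k) (j, k)

/-- The partial trace over the output `b` of a matrix on `b ⊗ E`. -/
def traceOut {b E : Type} [Fintype b] (M : Mat (b × E)) : Mat E :=
  Matrix.of fun k l => ∑ i, M (i, k) (i, l)

/-- Two quantum channels `Φ : M_a → M_b` and `Ψ : M_a → M_E` are complementary to each other if
there is an isometry `V : ℂ^a → ℂ^b ⊗ ℂ^E` with `Φ(X) = Tr_E (V X V†)` and `Ψ(X) = Tr_b (V X V†)`
for all `X`. -/
def IsComplementary {a b E : Type} [Fintype a] [DecidableEq a] [Fintype b] [Fintype E]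
    (Φ : Mat a →ₗ[ℂ] Mat b) (Ψ : Mat a →ₗ[ℂ] Mat E) : Prop :=
  IsQuantumChannel Φ ∧ IsQuantumChannel Ψ ∧
    ∃ V : Matrix (b × E) a ℂ, Vᴴ * V = 1 ∧
      ∀ X : Mat a, Φ X = traceEnv (V * X * Vᴴ) ∧ Ψ X = traceOut (V * X * Vᴴ)

/-- The coherent information `Q⁽¹⁾(Φ)`: the supremum of `S(Φ(ρ)) - S(Ψ(ρ))` over all states `ρ`,
where `Ψ` is a channel complementary to `Φ`. The difference does not depend on the choice of `Ψ`,
so that all choices are admitted here. -/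
def coherentInformation {a b : Type} [Fintype a] [DecidableEq a] [Fintype b] [DecidableEq b]
    (Φ : Mat a →ₗ[ℂ] Mat b) : ℝ :=
  sSup {x : ℝ | ∃ (E : Type) (_ : Fintype E) (_ : DecidableEq E) (Ψ : Mat a →ₗ[ℂ] Mat E)
    (ρ : Mat a), IsComplementary Φ Ψ ∧ IsState ρ ∧ x = entropy (Φ ρ) - entropy (Ψ ρ)}

/-- The tensor power `Φ^{⊗ n} : M_a^{⊗ n} → M_b^{⊗ n}`, where `M_a^{⊗ n}` is the algebra of
matrices indexed by `n`-tuples. It is the linear extension of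
`E_{k₁l₁} ⊗ ⋯ ⊗ E_{kₙlₙ} ↦ Φ(E_{k₁l₁}) ⊗ ⋯ ⊗ Φ(E_{kₙlₙ})` for the matrix units `E_{kl}`. -/
def tensorPower {a b : Type} [Fintype a] [DecidableEq a] (n : ℕ) (Φ : Mat a →ₗ[ℂ] Mat b) :
    Mat (Fin n → a) →ₗ[ℂ] Mat (Fin n → b) where
  toFun X := Matrix.of fun i j =>
    ∑ k, ∑ l, X k l * ∏ t, Φ (Matrix.single (k t) (l t) 1) (i t) (j t)
  map_add' X Y := by
    ext i j
    simp [add_mul, Finset.sum_add_distrib]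
  map_smul' c X := by
    ext i j
    simp [Finset.mul_sum, mul_assoc]

/-- `Q` is the quantum capacity of `Φ`: the limit of `Q⁽¹⁾(Φ^{⊗ n}) / n` as `n → ∞` exists and
equals `Q`. -/
def HasQuantumCapacity {a b : Type} [Fintype a] [DecidableEq a] [Fintype b] [DecidableEq b]
    (Φ : Mat a →ₗ[ℂ] Mat b) (Q : ℝ) : Prop :=
  Tendsto (fun n : ℕ => coherentInformation (tensorPower n Φ) / (n : ℝ)) atTop (𝓝 Q)

/-- The depolarizing map `X ↦ (1 - p) X + p Tr(X) 1/d` on `M_d`. -/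
def depolarizing (d : ℕ) (p : ℝ) : Mat (Fin d) →ₗ[ℂ] Mat (Fin d) where
  toFun X := (1 - (p : ℂ)) • X + ((p : ℂ) * X.trace / (d : ℂ)) • (1 : Mat (Fin d))
  map_add' X Y := by
    simp only [Matrix.trace_add, smul_add, mul_add, add_div, add_smul]
    abel
  map_smul' c X := by
    simp only [Matrix.trace_smul, smul_eq_mul, RingHom.id_apply, smul_add, smul_smul]
    congr 2 <;> ring

/-- The transpose-depolarizing map `X ↦ (1 - q) Xᵀ + q Tr(X) 1/d` on `M_d`. -/
def transposeDepolarizing (d : ℕ) (q : ℝ) : Mat (Fin d) →ₗ[ℂ] Mat (Fin d) where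
  toFun X := (1 - (q : ℂ)) • Xᵀ + ((q : ℂ) * X.trace / (d : ℂ)) • (1 : Mat (Fin d))
  map_add' X Y := by
    simp only [Matrix.transpose_add, Matrix.trace_add, smul_add, mul_add, add_div, add_smul]
    abel
  map_smul' c X := by
    simp only [Matrix.transpose_smul, Matrix.trace_smul, smul_eq_mul, RingHom.id_apply, smul_add,
      smul_smul]
    congr 2 <;> ring

/-- Check of `tensorPower`: it sends the tensor product of `X₁, …, Xₙ` to the tensor product of
`Φ(X₁), …, Φ(Xₙ)`. -/
theorem tensorPower_apply_prod {a b : Type} [Fintype a] [DecidableEq a] (n : ℕ)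
    (Φ : Mat a →ₗ[ℂ] Mat b) (X : Fin n → Mat a) :
    tensorPower n Φ (Matrix.of fun i j => ∏ t, X t (i t) (j t)) =
      Matrix.of fun i j => ∏ t, Φ (X t) (i t) (j t) := by
  ext i j
  have h : ∀ t, Φ (X t) (i t) (j t) =
      ∑ k, ∑ l, X t k l * Φ (Matrix.single k l 1) (i t) (j t) := by
    intro t
    conv_lhs => rw [Matrix.matrix_eq_sum_single (X t)]
    simp only [map_sum, Matrix.sum_apply]
    refine Finset.sum_congr rfl fun k _ => Finset.sum_congr rfl fun l _ => ?_
    have : Matrix.single k l (X t k l) = X t k l • Matrix.single k l (1 : ℂ) := by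
      simp [Matrix.smul_single]
    rw [this, map_smul]
    simp
  simp only [tensorPower, LinearMap.coe_mk, AddHom.coe_mk, Matrix.of_apply, h,
    Finset.prod_univ_sum, Fintype.piFinset_univ, Finset.prod_mul_distrib]

/-- Channel-ness is automatic for a pair of maps given by an isometry. -/
theorem IsComplementary.of_isometry {a b E : Type} [Fintype a] [DecidableEq a] [Fintype b]
    [Fintype E] {Φ : Mat a →ₗ[ℂ] Mat b} {Ψ : Mat a →ₗ[ℂ] Mat E} (V : Matrix (b × E) a ℂ)
    (hV : Vᴴ * V = 1)
    (h : ∀ X : Mat a, Φ X = traceEnv (V * X * Vᴴ) ∧ Ψ X = traceOut (V * X * Vᴴ)) :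
    IsComplementary Φ Ψ := by
  have htr : ∀ X : Mat a, (V * X * Vᴴ).trace = X.trace := by
    intro X
    rw [Matrix.trace_mul_comm, ← Matrix.mul_assoc, hV, Matrix.one_mul]
  refine ⟨⟨?_, ?_⟩, ⟨?_, ?_⟩, V, hV, h⟩
  · intro r X hX
    have key : ampliate r Φ X = ∑ c : E,
        (Matrix.of fun (s : Fin r × b) (u : Fin r × a) =>
          if s.1 = u.1 then V (s.2, c) u.2 else 0) * X *
        (Matrix.of fun (s : Fin r × b) (u : Fin r × a) =>
          if s.1 = u.1 then V (s.2, c) u.2 else 0)ᴴ := by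
      ext s t
      simp only [ampliate, (h _).1, traceEnv, Matrix.of_apply, Matrix.sum_apply, Matrix.mul_apply,
        Matrix.conjTranspose_apply, Fintype.sum_prod_type, apply_ite star, star_zero, ite_mul,
        mul_ite, zero_mul, mul_zero]
      refine Finset.sum_congr rfl fun c _ => ?_
      rw [Finset.sum_eq_single t.1 (fun x _ hx => by simp [Ne.symm hx]) (by simp)]
      simp only [if_true]
      refine Finset.sum_congr rfl fun j _ => ?_
      rw [Finset.sum_eq_single s.1 (fun x _ hx => by simp [Ne.symm hx]) (by simp)]
      simp
    rw [key]
    exact Matrix.posSemidef_sum _ fun c _ => hX.mul_mul_conjTranspose_same _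
  · intro X
    rw [← htr X, (h X).1]
    simp [traceEnv, Matrix.trace, Fintype.sum_prod_type]
  · intro r X hX
    have key : ampliate r Ψ X = ∑ c : b,
        (Matrix.of fun (s : Fin r × E) (u : Fin r × a) =>
          if s.1 = u.1 then V (c, s.2) u.2 else 0) * X *
        (Matrix.of fun (s : Fin r × E) (u : Fin r × a) =>
          if s.1 = u.1 then V (c, s.2) u.2 else 0)ᴴ := by
      ext s t
      simp only [ampliate, (h _).2, traceOut, Matrix.of_apply, Matrix.sum_apply, Matrix.mul_apply,
        Matrix.conjTranspose_apply, Fintype.sum_prod_type, apply_ite star, star_zero, ite_mul,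
        mul_ite, zero_mul, mul_zero]
      refine Finset.sum_congr rfl fun c _ => ?_
      rw [Finset.sum_eq_single t.1 (fun x _ hx => by simp [Ne.symm hx]) (by simp)]
      simp only [if_true]
      refine Finset.sum_congr rfl fun j _ => ?_
      rw [Finset.sum_eq_single s.1 (fun x _ hx => by simp [Ne.symm hx]) (by simp)]
      simp
    rw [key]
    exact Matrix.posSemidef_sum _ fun c _ => hX.mul_mul_conjTranspose_same _
  · intro X
    rw [← htr X, (h X).2]
    simp only [traceOut, Matrix.trace, Matrix.diag_apply, Matrix.of_apply, Fintype.sum_prod_type]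
    exact Finset.sum_comm

end QuantumChannels

end

/-! Feed both channels the state `ρ_ε = diag(1 - ε, ε, 0, …, 0)`. At `ε = 0` the input is pure, so
the two complementary outputs have the same entropy. The output of `D_p` or `D_q^⊤` there has
eigenvalues `1 - r + r/d` (once) and `r/d` (`d - 1` times), with `r = p` or `r = q`. All are
positive under the hypotheses, so its entropy is differentiable in `ε` at `0`. The complementary
output instead acquires eigenvalue weight proportional to `ε`, which contributes a term `-c ε log ε`
with infinite slope. Hence `S(Φ_c(ρ_ε)) > S(Φ(ρ_ε))` for small `ε > 0`, and one use of `Φ_c` already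
has positive coherent information.

The environment output is not computed for the given isometry: it shares its nonzero spectrum with
`purifiedOutput`, a Gram matrix depending only on `Φ` and the input
(`IsComplementary.posSemidef_and_entropy_eq`). Its entropy is bounded below by lumping one block
into a single eigenvalue (`block_le_entropy`), a bound still exact at `ε = 0`. The comparison of
slopes is `eventually_pos_add_mul_negMulLog`.

Product inputs make coherent information superadditive (`IsCoherentValue.tensorPower_add`), so
Fekete's lemma gives both existence of the capacity and the one-use lower bound
(`IsCoherentValue.exists_hasQuantumCapacity`). -/

namespace QuantumChannels

open Matrix Polynomial
open scoped Kronecker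

/-! ### Spectral facts about the von Neumann entropy -/

section Entropy

variable {a b : Type} [Fintype a] [DecidableEq a] [Fintype b] [DecidableEq b]

theorem entropy_of_isHermitian {A : Mat a} (h : A.IsHermitian) :
    entropy A = ∑ i, Real.negMulLog (h.eigenvalues i) := dif_pos h

/-- The entropy only depends on the characteristic polynomial. -/
theorem entropy_eq_sum_roots {A : Mat a} (h : A.IsHermitian) :
    entropy A = (A.charpoly.roots.map fun z => Real.negMulLog z.re).sum := by
  rw [entropy_of_isHermitian h, h.roots_charpoly_eq_eigenvalues, Multiset.map_map]
  exact congrArg Multiset.sum (Multiset.map_congr rfl fun i _ => by simp)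

theorem entropy_submatrix_equiv {A : Mat a} (h : A.IsHermitian) (e : b ≃ a) :
    entropy (A.submatrix e e) = entropy A := by
  rw [entropy_eq_sum_roots h, entropy_eq_sum_roots (h.submatrix e)]
  have := charpoly_reindex e.symm A
  simp only [reindex_apply, Equiv.symm_symm] at this
  rw [this]

/-- The two characteristic polynomials agree up to powers of `X`, and the extra zero roots
contribute `0 log 0 = 0`. -/
theorem entropy_mul_conjTranspose_comm (G : Matrix a b ℂ) :
    entropy (G * Gᴴ) = entropy (Gᴴ * G) := by
  rw [entropy_eq_sum_roots (isHermitian_mul_conjTranspose_self G),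
    entropy_eq_sum_roots (isHermitian_conjTranspose_mul_self G)]
  have h := charpoly_mul_comm' G Gᴴ
  have h1 := (charpoly_monic (G * Gᴴ)).ne_zero
  have h2 := (charpoly_monic (Gᴴ * G)).ne_zero
  have hX : ∀ n : ℕ, (X : ℂ[X]) ^ n ≠ 0 := fun n => pow_ne_zero _ X_ne_zero
  have h' := congrArg (fun p : ℂ[X] => (p.roots.map fun z => Real.negMulLog z.re).sum) h
  simpa [roots_mul (mul_ne_zero (hX _) h1), roots_mul (mul_ne_zero (hX _) h2),
    Multiset.map_nsmul, Multiset.sum_nsmul] using h'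

theorem entropy_unitary_conj_diagonal {U : Mat a} (hU : Uᴴ * U = 1) (f : a → ℝ) :
    entropy (U * diagonal (fun i => (f i : ℂ)) * Uᴴ) = ∑ i, Real.negMulLog (f i) := by
  have hd : (diagonal (fun i => (f i : ℂ))).IsHermitian :=
    isHermitian_diagonal_of_self_adjoint _ (by ext i; simp)
  rw [entropy_eq_sum_roots (isHermitian_mul_mul_conjTranspose U hd), Matrix.charpoly_mul_comm,
    ← mul_assoc, hU, one_mul, charpoly_diagonal, roots_prod _ _
      (Finset.prod_ne_zero_iff.2 fun i _ => X_sub_C_ne_zero _)]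
  simp

theorem entropy_diagonal (f : a → ℝ) :
    entropy (diagonal (fun i => (f i : ℂ))) = ∑ i, Real.negMulLog (f i) := by
  simpa using entropy_unitary_conj_diagonal (U := (1 : Mat a)) (by simp) f

theorem entropy_fromBlocks {A : Mat a} {B : Mat b} (hA : A.IsHermitian) (hB : B.IsHermitian) :
    entropy (fromBlocks A 0 0 B) = entropy A + entropy B := by
  have h : (fromBlocks A 0 0 B).IsHermitian := hA.fromBlocks (by simp) hB
  rw [entropy_eq_sum_roots h, entropy_eq_sum_roots hA, entropy_eq_sum_roots hB,
    charpoly_fromBlocks_zero₁₂, roots_mul, Multiset.map_add, Multiset.sum_add]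
  exact mul_ne_zero (charpoly_monic _).ne_zero (charpoly_monic _).ne_zero

/-- Monotonicity of `log`: each of `log x`, `log y` is at most `log (x + y)`. Through its finite-sum
form, this is why lumping eigenvalues together can only lower the entropy. -/
theorem negMulLog_add_le {x y : ℝ} (hx : 0 ≤ x) (hy : 0 ≤ y) :
    Real.negMulLog (x + y) ≤ Real.negMulLog x + Real.negMulLog y := by
  have key : ∀ {u v : ℝ}, 0 ≤ u → 0 ≤ v → u * Real.log u ≤ u * Real.log (u + v) := by
    intro u v hu hv
    rcases hu.eq_or_lt with rfl | hu
    · simp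
    · exact mul_le_mul_of_nonneg_left (Real.log_le_log hu (by linarith)) hu.le
  have h1 := key hx hy
  have h2 := key hy hx
  rw [add_comm y x] at h2
  simp only [Real.negMulLog]
  linarith [add_mul x y (Real.log (x + y))]

theorem negMulLog_sum_le {ι : Type*} (s : Finset ι) (f : ι → ℝ) (hf : ∀ i, 0 ≤ f i) :
    Real.negMulLog (∑ i ∈ s, f i) ≤ ∑ i ∈ s, Real.negMulLog (f i) := by
  classical
  induction s using Finset.induction_on with
  | empty => simp
  | insert i s hi ih =>
    rw [Finset.sum_insert hi, Finset.sum_insert hi]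
    exact (negMulLog_add_le (hf i) (Finset.sum_nonneg fun j _ => hf j)).trans (by gcongr)

theorem sum_eigenvalues_eq_trace_re {A : Mat a} (h : A.IsHermitian) :
    ∑ i, h.eigenvalues i = A.trace.re := by
  simpa using (congrArg Complex.re h.trace_eq_sum_eigenvalues).symm

theorem negMulLog_trace_le_entropy {A : Mat a} (h : A.PosSemidef) :
    Real.negMulLog A.trace.re ≤ entropy A := by
  rw [entropy_of_isHermitian h.isHermitian, ← sum_eigenvalues_eq_trace_re h.isHermitian]
  exact negMulLog_sum_le _ _ h.eigenvalues_nonneg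

theorem IsState.sum_eigenvalues {ρ : Mat a} (h : IsState ρ) :
    ∑ i, h.1.isHermitian.eigenvalues i = 1 := by
  rw [sum_eigenvalues_eq_trace_re, h.2, Complex.one_re]

theorem IsState.entropy_nonneg {ρ : Mat a} (h : IsState ρ) : 0 ≤ entropy ρ := by
  simpa [h.2] using negMulLog_trace_le_entropy h.1

theorem IsState.entropy_le_log_card {ρ : Mat a} (h : IsState ρ) :
    entropy ρ ≤ Real.log (Fintype.card a) := by
  have hsum := h.sum_eigenvalues
  set f := h.1.isHermitian.eigenvalues with hf
  have hne : Nonempty a := by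
    by_contra hne
    rw [not_nonempty_iff] at hne
    simp at hsum
  have hN : (0 : ℝ) < Fintype.card a := by exact_mod_cast Fintype.card_pos
  -- This is `-t log t ≤ 1 - t` at `t = N λ`, divided by the dimension `N`; the corrections `1/N -
  -- λ` sum to zero.
  have key : ∀ i, Real.negMulLog (f i) ≤
      f i * Real.log (Fintype.card a) + ((Fintype.card a : ℝ)⁻¹ - f i) := by
    intro i
    have hi : 0 ≤ f i := h.1.eigenvalues_nonneg i
    have h1 := Real.negMulLog_le_one_sub_self (mul_nonneg hN.le hi)
    rw [Real.negMulLog_mul] at h1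
    have h2 : (Fintype.card a : ℝ)⁻¹ * (f i * Real.negMulLog (Fintype.card a) +
        Fintype.card a * Real.negMulLog (f i)) ≤
        (Fintype.card a : ℝ)⁻¹ * (1 - Fintype.card a * f i) :=
      mul_le_mul_of_nonneg_left h1 (by positivity)
    have e1 : (Fintype.card a : ℝ)⁻¹ * (f i * Real.negMulLog (Fintype.card a) +
        Fintype.card a * Real.negMulLog (f i)) =
        - (f i * Real.log (Fintype.card a)) + Real.negMulLog (f i) := by
      rw [Real.negMulLog]
      field_simp
    have e2 : (Fintype.card a : ℝ)⁻¹ * (1 - Fintype.card a * f i) =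
        (Fintype.card a : ℝ)⁻¹ - f i := by
      field_simp
    linarith
  rw [entropy_of_isHermitian h.1.isHermitian]
  refine (Finset.sum_le_sum fun i _ => key i).trans ?_
  rw [Finset.sum_add_distrib, ← Finset.sum_mul, Finset.sum_sub_distrib, hsum]
  simp [hN.ne']

theorem entropy_kronecker {ρ : Mat a} {σ : Mat b} (hρ : IsState ρ) (hσ : IsState σ) :
    entropy (ρ ⊗ₖ σ) = entropy ρ + entropy σ := by
  have spec : ∀ {c : Type} [Fintype c] [DecidableEq c] {A : Mat c} (h : A.IsHermitian),
      ∃ U : Mat c, Uᴴ * U = 1 ∧ A = U * diagonal (fun i => (h.eigenvalues i : ℂ)) * Uᴴ := by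
    intro c _ _ A h
    refine ⟨h.eigenvectorUnitary, ?_, ?_⟩
    · exact Unitary.coe_star_mul_self h.eigenvectorUnitary
    · exact h.spectral_theorem
  obtain ⟨U, hU, hA⟩ := spec hρ.1.isHermitian
  obtain ⟨V, hV, hB⟩ := spec hσ.1.isHermitian
  have e1 := hρ.sum_eigenvalues
  have e2 := hσ.sum_eigenvalues
  rw [entropy_of_isHermitian hρ.1.isHermitian, entropy_of_isHermitian hσ.1.isHermitian]
  set f := hρ.1.isHermitian.eigenvalues
  set g := hσ.1.isHermitian.eigenvalues
  have hUV : (U ⊗ₖ V)ᴴ * (U ⊗ₖ V) = 1 := by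
    rw [conjTranspose_kronecker, ← mul_kronecker_mul, hU, hV, one_kronecker_one]
  have hk : ρ ⊗ₖ σ = (U ⊗ₖ V) * diagonal (fun i => ((f i.1 * g i.2 : ℝ) : ℂ)) * (U ⊗ₖ V)ᴴ := by
    rw [hA, hB, mul_kronecker_mul, mul_kronecker_mul, diagonal_kronecker_diagonal,
      conjTranspose_kronecker]
    simp
  rw [hk, entropy_unitary_conj_diagonal hUV, Fintype.sum_prod_type]
  simp only [Real.negMulLog_mul, Finset.sum_add_distrib, ← Finset.sum_mul, ← Finset.mul_sum, e1,
    e2, one_mul]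

/-- If all off-diagonal entries of a positive semidefinite matrix lie in one diagonal block, its
entropy is at least the one obtained by lumping the block into a single eigenvalue. -/
theorem block_le_entropy {H : Mat a} (hH : H.PosSemidef) (p : a → Prop) [DecidablePred p]
    (h0 : ∀ i j, i ≠ j → ¬ (p i ∧ p j) → H i j = 0) :
    Real.negMulLog (∑ i, if p i then (H i i).re else 0) +
      ∑ i, (if p i then 0 else Real.negMulLog (H i i).re) ≤ entropy H := by
  -- Sorting the indices by `p` makes `H` block diagonal, with a diagonal second block.
  have hd : H.submatrix (Equiv.sumCompl p) (Equiv.sumCompl p) =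
      fromBlocks (H.submatrix Subtype.val Subtype.val) 0 0
        (diagonal fun i : {i // ¬ p i} => (((H i i).re : ℝ) : ℂ)) := by
    ext i j
    rcases i with i | i <;> rcases j with j | j
    · simp
    · simp only [submatrix_apply, Equiv.sumCompl_apply_inl, Equiv.sumCompl_apply_inr,
        fromBlocks_apply₁₂, Matrix.zero_apply]
      exact h0 _ _ (fun h => j.2 (h ▸ i.2)) (fun h => j.2 h.2)
    · simp only [submatrix_apply, Equiv.sumCompl_apply_inl, Equiv.sumCompl_apply_inr,
        fromBlocks_apply₂₁, Matrix.zero_apply]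
      exact h0 _ _ (fun h => i.2 (h ▸ j.2)) (fun h => i.2 h.1)
    · simp only [submatrix_apply, Equiv.sumCompl_apply_inr, fromBlocks_apply₂₂]
      by_cases hij : i = j
      · subst hij
        rw [diagonal_apply_eq]
        exact (hH.isHermitian.coe_re_apply_self i.1).symm
      · rw [diagonal_apply_ne _ hij]
        exact h0 _ _ (fun h => hij (Subtype.ext h)) (fun h => i.2 h.1)
  rw [← entropy_submatrix_equiv hH.isHermitian (Equiv.sumCompl p), hd, entropy_fromBlocks
    (hH.isHermitian.submatrix _) (isHermitian_diagonal_of_self_adjoint _ (by ext i; simp)),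
    entropy_diagonal]
  have ht : (∑ i, if p i then (H i i).re else 0) =
      (H.submatrix (Subtype.val : {i // p i} → a) Subtype.val).trace.re := by
    rw [← Finset.sum_filter, Finset.sum_subtype (F := Subtype.fintype p) (Finset.univ.filter p) (by simp)
      (fun i => (H i i).re)]
    simp [trace]
  have hs : ∑ i, (if p i then 0 else Real.negMulLog (H i i).re) =
      ∑ i : {i // ¬ p i}, Real.negMulLog (H i i).re := by
    simp_rw [← ite_not (p := p _)]
    rw [← Finset.sum_filter, Finset.sum_subtype (F := Subtype.fintype _) (Finset.univ.filter fun i => ¬ p i)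
      (p := fun i => ¬ p i) (by simp) (fun i => Real.negMulLog (H i i).re)]
  rw [ht, hs]
  gcongr
  exact negMulLog_trace_le_entropy (hH.submatrix _)

end Entropy

end QuantumChannels

namespace QuantumChannels

open Matrix
open scoped Kronecker

/-! ### Isometries, partial traces and tensor powers -/

section Channels

variable {a b E : Type} [Fintype a] [Fintype E]

theorem traceEnv_conj_apply (V : Matrix (b × E) a ℂ) (X : Mat a) (i j : b) :
    traceEnv (V * X * Vᴴ) i j = ∑ k, ∑ l, X k l * ∑ e, V (i, e) k * star (V (j, e) l) := by
  simp only [traceEnv, of_apply, mul_apply, conjTranspose_apply, Finset.sum_mul, Finset.mul_sum]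
  rw [Finset.sum_comm]
  simp_rw [Finset.sum_comm (s := (Finset.univ : Finset E))]
  rw [Finset.sum_comm]
  refine Finset.sum_congr rfl fun k _ => Finset.sum_congr rfl fun l _ =>
    Finset.sum_congr rfl fun e _ => by ring

theorem traceEnv_conj_single [DecidableEq a] (V : Matrix (b × E) a ℂ) (k l : a) (i j : b) :
    traceEnv (V * single k l (1 : ℂ) * Vᴴ) i j = ∑ e, V (i, e) k * star (V (j, e) l) := by
  rw [traceEnv_conj_apply, Finset.sum_eq_single k, Finset.sum_eq_single l]
  · simp
  · intro l' _ hl; simp [single, hl.symm]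
  · simp
  · intro k' _ hk; simp [single, hk.symm]
  · simp

section Power

variable [DecidableEq a]

theorem tensorPower_apply (n : ℕ) (Φ : Mat a →ₗ[ℂ] Mat b) (X : Mat (Fin n → a))
    (i j : Fin n → b) :
    tensorPower n Φ X i j = ∑ k, ∑ l, X k l * ∏ t, Φ (single (k t) (l t) 1) (i t) (j t) := rfl

theorem tensorPower_single (n : ℕ) (Φ : Mat a →ₗ[ℂ] Mat b) (k l : Fin n → a)
    (i j : Fin n → b) :
    tensorPower n Φ (single k l 1) i j = ∏ t, Φ (single (k t) (l t) 1) (i t) (j t) := by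
  rw [tensorPower_apply, Finset.sum_eq_single k, Finset.sum_eq_single l]
  · simp
  · intro l' _ hl; simp [single, hl.symm]
  · simp
  · intro k' _ hk; simp [single, hk.symm]
  · simp

end Power

variable [Fintype b]

theorem IsQuantumChannel.isState {Φ : Mat a →ₗ[ℂ] Mat b} (h : IsQuantumChannel Φ) {ρ : Mat a}
    (hρ : IsState ρ) : IsState (Φ ρ) := by
  refine ⟨?_, (h.2 ρ).trans hρ.2⟩
  -- Positivity is the case `r = 1` of complete positivity.
  have h1 := h.1 1 (ρ.submatrix Prod.snd Prod.snd) (hρ.1.submatrix _)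
  exact h1.submatrix (fun i : b => ((0 : Fin 1), i))

theorem IsState.submatrix_equiv {ρ : Mat a} (h : IsState ρ) (e : b ≃ a) :
    IsState (ρ.submatrix e e) := by
  refine ⟨h.1.submatrix e, ?_⟩
  rw [← h.2]
  exact Equiv.sum_comp e fun i => ρ i i

theorem IsState.kronecker {ρ : Mat a} {σ : Mat b} (hρ : IsState ρ) (hσ : IsState σ) :
    IsState (ρ ⊗ₖ σ) :=
  ⟨hρ.1.kronecker hσ.1, by rw [trace_kronecker, hρ.2, hσ.2, one_mul]⟩

/-- The channel to the environment defined by `V`. -/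
def envChannel (V : Matrix (b × E) a ℂ) : Mat a →ₗ[ℂ] Mat E where
  toFun X := traceOut (V * X * Vᴴ)
  map_add' X Y := by
    ext i j
    simp [traceOut, Matrix.mul_add, Matrix.add_mul, Finset.sum_add_distrib]
  map_smul' c X := by
    ext i j
    simp [traceOut, Finset.mul_sum]

/-! ### Coherent information, superadditivity and existence of the capacity -/

variable [DecidableEq a] [DecidableEq b]

/-- The value of the coherent information of `Φ` at some input state. -/
def IsCoherentValue (Φ : Mat a →ₗ[ℂ] Mat b) (x : ℝ) : Prop :=
  ∃ (E : Type) (_ : Fintype E) (_ : DecidableEq E) (Ψ : Mat a →ₗ[ℂ] Mat E)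
    (ρ : Mat a), IsComplementary Φ Ψ ∧ IsState ρ ∧ x = entropy (Φ ρ) - entropy (Ψ ρ)

theorem IsCoherentValue.le_log_card {Φ : Mat a →ₗ[ℂ] Mat b} {x : ℝ} (h : IsCoherentValue Φ x) :
    x ≤ Real.log (Fintype.card b) := by
  obtain ⟨E, _, _, Ψ, ρ, hc, hρ, rfl⟩ := h
  have h1 := (hc.1.isState hρ).entropy_le_log_card
  have h2 := (hc.2.1.isState hρ).entropy_nonneg
  linarith

theorem bddAbove_isCoherentValue (Φ : Mat a →ₗ[ℂ] Mat b) :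
    BddAbove {x | IsCoherentValue Φ x} :=
  ⟨_, fun _ hx => IsCoherentValue.le_log_card hx⟩

/-- `Subadditive` quantifies over `0` as well, so the set of values must be nonempty there too. All
spaces involved are one-dimensional and both entropies vanish. -/
theorem isCoherentValue_tensorPower_zero (Φ : Mat a →ₗ[ℂ] Mat b) :
    IsCoherentValue (tensorPower 0 Φ) 0 := by
  let V : Matrix ((Fin 0 → b) × Unit) (Fin 0 → a) ℂ := of fun _ _ => 1
  have hV : Vᴴ * V = 1 := by
    ext i j
    rw [Subsingleton.elim i j]
    simp [V, mul_apply]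
  have hc : IsComplementary (tensorPower 0 Φ) (envChannel V) := by
    refine IsComplementary.of_isometry V hV fun X => ⟨?_, rfl⟩
    ext i j
    rw [traceEnv_conj_apply, tensorPower_apply]
    simp [V]
  have hρ : IsState (1 : Mat (Fin 0 → a)) := ⟨PosSemidef.one, by simp⟩
  refine ⟨Unit, inferInstance, inferInstance, envChannel V, 1, hc, hρ, ?_⟩
  have h1 := (hc.1.isState hρ)
  have h2 := (hc.2.1.isState hρ)
  have e1 := h1.entropy_le_log_card
  have e2 := h2.entropy_le_log_card
  have e3 := h1.entropy_nonneg
  have e4 := h2.entropy_nonneg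
  simp at e1 e2
  linarith

/-- Complementarity is symmetric: the same isometry, with output and environment exchanged, dilates
`Ψ`. The rest is the identification of one-tuples with single indices. -/
theorem IsComplementary.isCoherentValue_tensorPower_one {Φ : Mat a →ₗ[ℂ] Mat b}
    [DecidableEq E] {Ψ : Mat a →ₗ[ℂ] Mat E} (h : IsComplementary Φ Ψ) {ρ : Mat a} (hρ : IsState ρ) :
    IsCoherentValue (tensorPower 1 Ψ) (entropy (Ψ ρ) - entropy (Φ ρ)) := by
  obtain ⟨hΦ, hΨ, V, hV, hVX⟩ := h
  let ea : (Fin 1 → a) ≃ a := Equiv.funUnique (Fin 1) a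
  let eE : (Fin 1 → E) ≃ E := Equiv.funUnique (Fin 1) E
  let f : (Fin 1 → E) × b ≃ b × E := (eE.prodCongr (Equiv.refl b)).trans (Equiv.prodComm E b)
  let W : Matrix ((Fin 1 → E) × b) (Fin 1 → a) ℂ := V.submatrix f ea
  have hWX : ∀ Y : Mat a, W * Y.submatrix ea ea * Wᴴ = (V * Y * Vᴴ).submatrix f f := by
    intro Y
    simp only [W, conjTranspose_submatrix, submatrix_mul_equiv]
  have hout : ∀ Y : Mat a, traceEnv (W * Y.submatrix ea ea * Wᴴ) = (Ψ Y).submatrix eE eE := by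
    intro Y
    rw [hWX, (hVX Y).2]
    rfl
  have henv : ∀ Y : Mat a, envChannel W (Y.submatrix ea ea) = Φ Y := by
    intro Y
    change traceOut (W * Y.submatrix ea ea * Wᴴ) = _
    rw [hWX, (hVX Y).1]
    ext i j
    exact Equiv.sum_comp eE fun e => (V * Y * Vᴴ) (i, e) (j, e)
  have hpow : ∀ Y : Mat a, tensorPower 1 Ψ (Y.submatrix ea ea) = (Ψ Y).submatrix eE eE := by
    intro Y
    have h1 := tensorPower_apply_prod 1 Ψ fun _ => Y
    simp only [Finset.univ_unique, Finset.prod_singleton] at h1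
    exact h1
  have hW : Wᴴ * W = 1 := by
    simp only [W, conjTranspose_submatrix, submatrix_mul_equiv, hV, submatrix_one_equiv]
  refine ⟨b, inferInstance, inferInstance, envChannel W, ρ.submatrix ea ea, ?_,
    hρ.submatrix_equiv ea, ?_⟩
  · refine IsComplementary.of_isometry W hW fun X => ⟨?_, rfl⟩
    have hX : X = (X.submatrix ea.symm ea.symm).submatrix ea ea := by
      simp [submatrix_submatrix]
    rw [hX, hpow, hout]
  · rw [henv, hpow, entropy_submatrix_equiv (hΨ.isState hρ).1.isHermitian]

/-- The tensor product of the two isometries dilates the larger power. On a product input both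
outputs are products, and entropy is additive on them. -/
theorem IsCoherentValue.tensorPower_add {Φ : Mat a →ₗ[ℂ] Mat b} {m n : ℕ} {x y : ℝ}
    (hx : IsCoherentValue (tensorPower m Φ) x) (hy : IsCoherentValue (tensorPower n Φ) y) :
    IsCoherentValue (tensorPower (m + n) Φ) (x + y) := by
  obtain ⟨E, _, _, Ψ, ρ, ⟨hΦ₁, hΨ₁, V, hV, hVX⟩, hρ, rfl⟩ := hx
  obtain ⟨F, _, _, Θ, σ, ⟨hΦ₂, hΨ₂, U, hU, hUX⟩, hσ, rfl⟩ := hy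
  let ga : (Fin (m + n) → a) ≃ (Fin m → a) × (Fin n → a) := (Fin.appendEquiv m n).symm
  let gb : (Fin (m + n) → b) ≃ (Fin m → b) × (Fin n → b) := (Fin.appendEquiv m n).symm
  let f : (Fin (m + n) → b) × (E × F) ≃ ((Fin m → b) × E) × ((Fin n → b) × F) :=
    (gb.prodCongr (Equiv.refl _)).trans (Equiv.prodProdProdComm _ _ _ _)
  let W : Matrix ((Fin (m + n) → b) × (E × F)) (Fin (m + n) → a) ℂ := (V ⊗ₖ U).submatrix f ga
  have hW : Wᴴ * W = 1 := by
    simp only [W, conjTranspose_submatrix, submatrix_mul_equiv, conjTranspose_kronecker,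
      ← mul_kronecker_mul, hV, hU, one_kronecker_one, submatrix_one_equiv]
  have hpow : ∀ X, tensorPower (m + n) Φ X = traceEnv (W * X * Wᴴ) := by
    intro X
    ext i j
    rw [tensorPower_apply, traceEnv_conj_apply]
    refine Finset.sum_congr rfl fun k _ => Finset.sum_congr rfl fun l _ => congrArg _ ?_
    have h1 := tensorPower_single m Φ (ga k).1 (ga l).1 (gb i).1 (gb j).1
    have h2 := tensorPower_single n Φ (ga k).2 (ga l).2 (gb i).2 (gb j).2
    rw [(hVX _).1, traceEnv_conj_single] at h1
    rw [(hUX _).1, traceEnv_conj_single] at h2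
    rw [Fin.prod_univ_add]
    refine (congrArg₂ (· * ·) h1.symm h2.symm).trans ?_
    rw [Finset.sum_mul_sum, ← Finset.univ_product_univ, Finset.sum_product]
    refine Finset.sum_congr rfl fun e _ => Finset.sum_congr rfl fun e' _ => ?_
    simp only [W, f, submatrix_apply, kroneckerMap_apply, Equiv.trans_apply, Equiv.prodCongr_apply,
      Prod.map, Equiv.refl_apply, Equiv.prodProdProdComm_apply, star_mul']
    ring
  have hWX : W * (ρ ⊗ₖ σ).submatrix ga ga * Wᴴ = ((V * ρ * Vᴴ) ⊗ₖ (U * σ * Uᴴ)).submatrix f f := by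
    simp only [W, conjTranspose_submatrix, submatrix_mul_equiv, conjTranspose_kronecker,
      ← mul_kronecker_mul]
  have hout : tensorPower (m + n) Φ ((ρ ⊗ₖ σ).submatrix ga ga) =
      (tensorPower m Φ ρ ⊗ₖ tensorPower n Φ σ).submatrix gb gb := by
    rw [hpow, hWX, (hVX ρ).1, (hUX σ).1]
    ext i j
    simp only [traceEnv, of_apply, submatrix_apply, kroneckerMap_apply, f, Equiv.trans_apply,
      Equiv.prodCongr_apply, Prod.map, Equiv.refl_apply, Equiv.prodProdProdComm_apply,
      Finset.sum_mul_sum]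
    rw [← Finset.univ_product_univ, Finset.sum_product]
  have henv : envChannel W ((ρ ⊗ₖ σ).submatrix ga ga) = Ψ ρ ⊗ₖ Θ σ := by
    change traceOut (W * (ρ ⊗ₖ σ).submatrix ga ga * Wᴴ) = _
    rw [hWX, (hVX ρ).2, (hUX σ).2]
    ext i j
    simp only [traceOut, of_apply, submatrix_apply, kroneckerMap_apply, f, Equiv.trans_apply,
      Equiv.prodCongr_apply, Prod.map, Equiv.refl_apply, Equiv.prodProdProdComm_apply,
      Finset.sum_mul_sum]
    rw [← Finset.sum_product', Finset.univ_product_univ]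
    exact Equiv.sum_comp gb fun s => (V * ρ * Vᴴ) (s.1, i.1) (s.1, j.1) *
      (U * σ * Uᴴ) (s.2, i.2) (s.2, j.2)
  refine ⟨E × F, inferInstance, inferInstance, envChannel W, (ρ ⊗ₖ σ).submatrix ga ga,
    IsComplementary.of_isometry W hW fun X => ⟨hpow X, rfl⟩,
    (hρ.kronecker hσ).submatrix_equiv ga, ?_⟩
  have s1 := hΦ₁.isState hρ
  have s2 := hΦ₂.isState hσ
  rw [hout, henv, entropy_submatrix_equiv (s1.kronecker s2).1.isHermitian,
    entropy_kronecker s1 s2, entropy_kronecker (hΨ₁.isState hρ) (hΨ₂.isState hσ)]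
  ring

/-- If the coherent information of `Φ` takes the value `x`, then `Φ` has a quantum capacity, and
it is at least `x`. -/
theorem IsCoherentValue.exists_hasQuantumCapacity {Φ : Mat a →ₗ[ℂ] Mat b} {x : ℝ}
    (hx : IsCoherentValue (tensorPower 1 Φ) x) : ∃ Q, HasQuantumCapacity Φ Q ∧ x ≤ Q := by
  have hne : ∀ n, ∃ y, IsCoherentValue (tensorPower n Φ) y := by
    intro n
    induction n with
    | zero => exact ⟨0, isCoherentValue_tensorPower_zero Φ⟩
    | succ n ih =>
      obtain ⟨y, hy⟩ := ih
      exact ⟨y + x, hy.tensorPower_add hx⟩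
  let u : ℕ → ℝ := fun n => - coherentInformation (tensorPower n Φ)
  have hu : Subadditive u := by
    intro m n
    have : coherentInformation (tensorPower m Φ) + coherentInformation (tensorPower n Φ) ≤
        coherentInformation (tensorPower (m + n) Φ) := by
      rw [← le_sub_iff_add_le]
      refine csSup_le (hne m) fun y hy => ?_
      rw [le_sub_comm]
      refine csSup_le (hne n) fun z hz => ?_
      rw [le_sub_iff_add_le']
      exact le_csSup (bddAbove_isCoherentValue _) (IsCoherentValue.tensorPower_add hy hz)
    simp only [u]
    linarith
  have hbdd : BddBelow (Set.range fun n => u n / n) := by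
    -- A nonpositive bound also covers `n = 0`, where the quotient is `0` by convention.
    refine ⟨- |Real.log (Fintype.card b)|, ?_⟩
    rintro _ ⟨n, rfl⟩
    have h1 : coherentInformation (tensorPower n Φ) ≤ n * Real.log (Fintype.card b) := by
      refine csSup_le (hne n) fun y hy => (IsCoherentValue.le_log_card hy).trans ?_
      simp
    rcases Nat.eq_zero_or_pos n with rfl | hn
    · simp
    · have hn' : (0 : ℝ) < n := by exact_mod_cast hn
      simp only [u]
      rw [le_div_iff₀ hn']
      nlinarith [le_abs_self (Real.log (Fintype.card b))]
  refine ⟨- hu.lim, ?_, ?_⟩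
  · have := (hu.tendsto_lim hbdd).neg
    refine this.congr fun n => ?_
    simp [u, neg_div]
  · have h1 := hu.lim_le_div hbdd one_ne_zero
    have h2 : x ≤ coherentInformation (tensorPower 1 Φ) :=
      le_csSup (bddAbove_isCoherentValue _) hx
    simp [u] at h1
    linarith

end Channels

end QuantumChannels

namespace QuantumChannels

open Matrix

/-! ### The environment output as a Gram matrix -/

section Gram

variable {a b E : Type} [Fintype a] [DecidableEq a] [Fintype b] [DecidableEq b] [Fintype E]
  [DecidableEq E]

/-- The output of `id ⊗ Φ` on the canonical purification of the diagonal state with spectrum `w`,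
up to transposition. -/
noncomputable def purifiedOutput (Φ : Mat a →ₗ[ℂ] Mat b) (w : a → ℝ) : Mat (b × a) :=
  of fun x y => (√(w x.2) : ℂ) * (√(w y.2) : ℂ) * Φ (single y.2 x.2 1) y.1 x.1

theorem IsComplementary.posSemidef_and_entropy_eq {Φ : Mat a →ₗ[ℂ] Mat b} {Ψ : Mat a →ₗ[ℂ] Mat E}
    (h : IsComplementary Φ Ψ) {w : a → ℝ} (hw : ∀ k, 0 ≤ w k) :
    (purifiedOutput Φ w).PosSemidef ∧
      entropy (Ψ (diagonal fun k => (w k : ℂ))) = entropy (purifiedOutput Φ w) := by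
  obtain ⟨-, -, V, -, hVX⟩ := h
  -- `G` reshapes `V √ρ`: contracting its environment index leaves only data of `Φ`, and contracting
  -- the other index gives `Ψ ρ`.
  let G : Matrix E (b × a) ℂ := of fun e x => V (x.1, e) x.2 * (√(w x.2) : ℂ)
  have h1 : purifiedOutput Φ w = Gᴴ * G := by
    ext x y
    simp only [purifiedOutput, of_apply, (hVX _).1, traceEnv_conj_single, mul_apply, G,
      conjTranspose_apply, Finset.mul_sum, star_mul', RCLike.star_def, Complex.conj_ofReal]
    exact Finset.sum_congr rfl fun e _ => by ring
  have h2 : Ψ (diagonal fun k => (w k : ℂ)) = G * Gᴴ := by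
    ext e f
    have h3 : ∀ i, (V * diagonal (fun k => (w k : ℂ)) * Vᴴ) (i, e) (i, f) =
        ∑ k, V (i, e) k * w k * star (V (i, f) k) := fun i => by
      rw [mul_apply]
      simp only [mul_diagonal, conjTranspose_apply]
    simp only [(hVX _).2, traceOut, of_apply, h3]
    simp only [of_apply, mul_apply, G, conjTranspose_apply,
      star_mul', RCLike.star_def, Complex.conj_ofReal, Fintype.sum_prod_type]
    refine Finset.sum_congr rfl fun i _ => Finset.sum_congr rfl fun k _ => ?_
    have : ((w k : ℝ) : ℂ) = (√(w k) : ℂ) * (√(w k) : ℂ) := by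
      rw [← Complex.ofReal_mul, Real.mul_self_sqrt (hw k)]
    rw [this]
    ring
  exact ⟨h1 ▸ posSemidef_conjTranspose_mul_self G,
    by rw [h1, h2, entropy_mul_conjTranspose_comm]⟩

theorem isState_diagonal {w : a → ℝ} (hw : ∀ k, 0 ≤ w k) (h1 : ∑ k, w k = 1) :
    IsState (diagonal fun k => (w k : ℂ)) := by
  refine ⟨PosSemidef.diagonal fun k => by simpa using hw k, ?_⟩
  rw [trace_diagonal]
  exact_mod_cast h1

end Gram

/-! ### Explicit matrices for the two families -/

section Depolarizing

variable {d : ℕ}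

theorem purifiedOutput_depolarizing (p : ℝ) (w : Fin d → ℝ) (x y : Fin d × Fin d) :
    purifiedOutput (depolarizing d p) w x y = (√(w x.2) : ℂ) * (√(w y.2) : ℂ) *
      ((if x.1 = x.2 ∧ y.1 = y.2 then 1 - (p : ℂ) else 0) + if x = y then (p / d : ℂ) else 0) := by
  obtain ⟨i, k⟩ := x
  obtain ⟨j, l⟩ := y
  simp only [purifiedOutput, depolarizing, LinearMap.coe_mk, AddHom.coe_mk, of_apply, Matrix.add_apply,
    Matrix.smul_apply, single_apply, one_apply, smul_eq_mul, Prod.mk.injEq]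
  congr 2
  · simp [and_comm, eq_comm]
  · by_cases h : l = k
    · subst h
      simp [eq_comm]
    · simp [trace_single_eq_of_ne _ _ _ h, Ne.symm h]

theorem purifiedOutput_transposeDepolarizing (q : ℝ) (w : Fin d → ℝ) (x y : Fin d × Fin d) :
    purifiedOutput (transposeDepolarizing d q) w x y = (√(w x.2) : ℂ) * (√(w y.2) : ℂ) *
      ((if x.1 = y.2 ∧ y.1 = x.2 then 1 - (q : ℂ) else 0) + if x = y then (q / d : ℂ) else 0) := by
  obtain ⟨i, k⟩ := x
  obtain ⟨j, l⟩ := y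
  simp only [purifiedOutput, transposeDepolarizing, LinearMap.coe_mk, AddHom.coe_mk, of_apply,
    Matrix.add_apply, Matrix.smul_apply, single_apply, one_apply, smul_eq_mul, Prod.mk.injEq, transpose_apply]
  congr 2
  · simp [eq_comm]
  · by_cases h : l = k
    · subst h
      simp [eq_comm]
    · simp [trace_single_eq_of_ne _ _ _ h, Ne.symm h]

theorem re_purifiedOutput_depolarizing_self (p : ℝ) {w : Fin d → ℝ} (hw : ∀ k, 0 ≤ w k)
    (x : Fin d × Fin d) : (purifiedOutput (depolarizing d p) w x x).re =
      w x.2 * ((if x.1 = x.2 then 1 - p else 0) + p / d) := by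
  rw [purifiedOutput_depolarizing, ← Complex.ofReal_mul, Real.mul_self_sqrt (hw _),
    Complex.re_ofReal_mul]
  have : ((p : ℂ) / d).re = p / d := by exact_mod_cast Complex.ofReal_re (p / d)
  split_ifs <;> simp_all

theorem re_purifiedOutput_transposeDepolarizing_self (q : ℝ) {w : Fin d → ℝ}
    (hw : ∀ k, 0 ≤ w k) (x : Fin d × Fin d) :
    (purifiedOutput (transposeDepolarizing d q) w x x).re =
      w x.2 * ((if x.1 = x.2 then 1 - q else 0) + q / d) := by
  rw [purifiedOutput_transposeDepolarizing, ← Complex.ofReal_mul, Real.mul_self_sqrt (hw _),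
    Complex.re_ofReal_mul]
  have : ((q : ℂ) / d).re = q / d := by exact_mod_cast Complex.ofReal_re (q / d)
  split_ifs <;> simp_all

theorem entropy_depolarizing_diagonal (p : ℝ) {w : Fin d → ℝ} (h1 : ∑ k, w k = 1) :
    entropy (depolarizing d p (diagonal fun k => (w k : ℂ))) =
      ∑ k, Real.negMulLog ((1 - p) * w k + p / d) := by
  rw [← entropy_diagonal]
  congr 1
  have ht : ∑ k, (w k : ℂ) = 1 := by exact_mod_cast h1
  ext i j
  by_cases h : i = j
  · subst h
    simp [depolarizing, trace_diagonal, ht]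
  · simp [depolarizing, h]

theorem entropy_transposeDepolarizing_diagonal (q : ℝ) {w : Fin d → ℝ} (h1 : ∑ k, w k = 1) :
    entropy (transposeDepolarizing d q (diagonal fun k => (w k : ℂ))) =
      ∑ k, Real.negMulLog ((1 - q) * w k + q / d) := by
  rw [← entropy_depolarizing_diagonal q h1]
  simp [depolarizing, transposeDepolarizing]

end Depolarizing

/-! ### Entropy bounds at the two-level input -/

section TwoLevel

variable {n : ℕ}

/-- The probability vector `(1 - ε, ε, 0, …, 0)`. -/
noncomputable def twoLevel (n : ℕ) (ε : ℝ) : Fin (n + 2) → ℝ := Fin.cons (1 - ε) (Fin.cons ε 0)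

@[simp] theorem twoLevel_zero (ε : ℝ) : twoLevel n ε 0 = 1 - ε := rfl

@[simp] theorem twoLevel_one (ε : ℝ) : twoLevel n ε 1 = ε := rfl

@[simp] theorem twoLevel_succ_succ (ε : ℝ) (k : Fin n) : twoLevel n ε k.succ.succ = 0 := rfl

theorem sum_eq_of_two (f : Fin (n + 2) → ℝ) :
    ∑ k, f k = f 0 + f 1 + ∑ k : Fin n, f k.succ.succ := by
  rw [Fin.sum_univ_succ, Fin.sum_univ_succ, ← add_assoc]
  rfl

theorem sum_twoLevel (ε : ℝ) : ∑ k, twoLevel n ε k = 1 := by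
  simp [sum_eq_of_two]

theorem twoLevel_nonneg {ε : ℝ} (h0 : 0 ≤ ε) (h1 : ε ≤ 1) (k : Fin (n + 2)) :
    0 ≤ twoLevel n ε k := by
  refine Fin.cases ?_ (fun k => Fin.cases ?_ (fun k => ?_) k) k
  · simpa using h1
  · simpa using h0
  · simp

theorem sum_negMulLog_twoLevel (r s ε : ℝ) :
    ∑ k, Real.negMulLog (r * twoLevel n ε k + s) = Real.negMulLog (r * (1 - ε) + s) +
      Real.negMulLog (r * ε + s) + n * Real.negMulLog s := by
  simp [sum_eq_of_two]

variable {E : Type} [Fintype E] [DecidableEq E]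
  {Ψ : Mat (Fin (n + 2)) →ₗ[ℂ] Mat E}

/-- The only off-diagonal entries couple the pairs `(i, i)`, through the rank-one term of weight `1
- p`. That block has trace `1 - p + p/d`, and each weight `w k` leaves `d - 1 = n + 1` diagonal
entries `w k * p/d` outside it. -/
theorem le_entropy_depolarizing_complement {p ε : ℝ} (h0 : 0 ≤ ε) (h1 : ε ≤ 1)
    (h : IsComplementary (depolarizing (n + 2) p) Ψ) :
    Real.negMulLog (1 - p + p / (n + 2 : ℕ)) +
      (n + 1) * (Real.negMulLog ((1 - ε) * (p / (n + 2 : ℕ))) +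
        Real.negMulLog (ε * (p / (n + 2 : ℕ)))) ≤
      entropy (Ψ (diagonal fun k => (twoLevel n ε k : ℂ))) := by
  have hw := twoLevel_nonneg (n := n) h0 h1
  obtain ⟨hH, he⟩ := h.posSemidef_and_entropy_eq hw
  rw [he]
  refine le_trans (le_of_eq ?_) (block_le_entropy hH (fun x => x.1 = x.2) ?_)
  · simp only [re_purifiedOutput_depolarizing_self p hw, Fintype.sum_prod_type]
    congr 1
    · congr 1
      have : ∀ i k : Fin (n + 2), (if i = k then twoLevel n ε k *
          ((if i = k then 1 - p else 0) + p / (n + 2 : ℕ)) else 0) =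
          if i = k then twoLevel n ε k * (1 - p + p / (n + 2 : ℕ)) else 0 := by
        intro i k
        split_ifs <;> rfl
      simp only [this, Finset.sum_ite_eq, Finset.mem_univ, if_true, ← Finset.sum_mul,
        sum_twoLevel, one_mul]
    · rw [Finset.sum_comm]
      have : ∀ i k : Fin (n + 2), (if i = k then 0 else Real.negMulLog (twoLevel n ε k *
          ((if i = k then 1 - p else 0) + p / (n + 2 : ℕ)))) =
          Real.negMulLog (twoLevel n ε k * (p / (n + 2 : ℕ))) -
            if i = k then Real.negMulLog (twoLevel n ε k * (p / (n + 2 : ℕ))) else 0 := by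
        intro i k
        split_ifs <;> simp
      simp only [this, Finset.sum_sub_distrib, Finset.sum_ite_eq', Finset.mem_univ, if_true,
        Finset.sum_const, Finset.card_univ, Fintype.card_fin, nsmul_eq_mul]
      simp only [sum_eq_of_two, twoLevel_zero, twoLevel_one, twoLevel_succ_succ, zero_mul,
        Real.negMulLog_zero, mul_zero, Finset.sum_const_zero]
      push_cast
      ring
  · intro x y hxy hnot
    rw [purifiedOutput_depolarizing, if_neg hxy, if_neg hnot]
    simp

/-- Transposition produces a weighted swap, coupling `(i, k)` with `(k, i)` with strength `√(w i * w
k)`. For two-level weights only `(0, 1)` and `(1, 0)` are coupled, and their block has trace `q/d`.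
The entry at `(1, 1)` supplies the small eigenvalue `ε * (1 - q + q/d)`. -/
theorem le_entropy_transposeDepolarizing_complement {q ε : ℝ} (h0 : 0 ≤ ε) (h1 : ε ≤ 1)
    (h : IsComplementary (transposeDepolarizing (n + 2) q) Ψ) :
    Real.negMulLog (q / (n + 2 : ℕ)) +
      (Real.negMulLog ((1 - ε) * (1 - q + q / (n + 2 : ℕ))) +
        Real.negMulLog (ε * (1 - q + q / (n + 2 : ℕ))) +
        n * (Real.negMulLog ((1 - ε) * (q / (n + 2 : ℕ))) +
          Real.negMulLog (ε * (q / (n + 2 : ℕ))))) ≤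
      entropy (Ψ (diagonal fun k => (twoLevel n ε k : ℂ))) := by
  have hw := twoLevel_nonneg (n := n) h0 h1
  obtain ⟨hH, he⟩ := h.posSemidef_and_entropy_eq hw
  rw [he]
  refine le_trans (le_of_eq ?_) (block_le_entropy hH (fun x => x = (0, 1) ∨ x = (1, 0)) ?_)
  · have e1 : ∀ k : Fin n, (k.succ.succ : Fin (n + 2)) ≠ 1 := fun k h => by
      simp [Fin.ext_iff] at h
    simp only [re_purifiedOutput_transposeDepolarizing_self q hw, Fintype.sum_prod_type_right]
    simp [sum_eq_of_two, e1, (e1 _).symm]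
    rw [← add_mul, sub_add_cancel, one_mul]
    ring
  · rintro ⟨i, k⟩ ⟨j, l⟩ hxy hnot
    rw [purifiedOutput_transposeDepolarizing, if_neg hxy]
    by_cases hs : i = l ∧ j = k
    · obtain ⟨rfl, rfl⟩ := hs
      suffices hz : twoLevel n ε j = 0 ∨ twoLevel n ε i = 0 by
        rcases hz with hz | hz <;> simp [hz]
      induction i using Fin.cases with
      | zero =>
        induction j using Fin.cases with
        | zero => exact absurd rfl hxy
        | succ j =>
          induction j using Fin.cases with
          | zero => exact absurd ⟨Or.inl rfl, Or.inr rfl⟩ hnot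
          | succ j => simp
      | succ i =>
        induction i using Fin.cases with
        | zero =>
          induction j using Fin.cases with
          | zero => exact absurd ⟨Or.inr rfl, Or.inl rfl⟩ hnot
          | succ j =>
            induction j using Fin.cases with
            | zero => exact absurd rfl hxy
            | succ j => simp
        | succ i => simp
    · simp [hs]

end TwoLevel

/-! ### Infinite slope at zero and positivity of the capacity -/

/-- After division by `ε`, the first term tends to `g'(0)` while the second is `-c s log (ε s)`,
which tends to `+∞`. -/
theorem eventually_pos_add_mul_negMulLog {g : ℝ → ℝ} (hg : DifferentiableAt ℝ g 0) (h0 : g 0 = 0)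
    {c s : ℝ} (hc : 0 < c) (hs : 0 < s) :
    ∀ᶠ ε in 𝓝[>] (0 : ℝ), 0 < g ε + c * Real.negMulLog (ε * s) := by
  have h1 : Tendsto (fun ε => ε⁻¹ * g ε) (𝓝[>] 0) (𝓝 (deriv g 0)) := by
    have := hg.hasDerivAt.tendsto_slope_zero_right
    simpa [h0] using this
  have h2 : Tendsto (fun ε => c * s * -Real.log (ε * s)) (𝓝[>] 0) atTop := by
    refine Tendsto.const_mul_atTop (mul_pos hc hs) (tendsto_neg_atBot_atTop.comp
      (Real.tendsto_log_nhdsGT_zero.comp ?_))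
    refine tendsto_nhdsWithin_iff.2 ⟨?_, ?_⟩
    · have : Tendsto (fun ε : ℝ => ε * s) (𝓝 0) (𝓝 (0 * s)) := tendsto_id.mul_const s
      rw [zero_mul] at this
      exact this.mono_left nhdsWithin_le_nhds
    · filter_upwards [self_mem_nhdsWithin] with ε hε using mul_pos hε hs
  filter_upwards [(h1.add_atTop h2).eventually_gt_atTop 0, self_mem_nhdsWithin] with ε hε hpos
  have hpos' : (0 : ℝ) < ε := hpos
  have e : g ε + c * Real.negMulLog (ε * s) = ε * (ε⁻¹ * g ε + c * s * -Real.log (ε * s)) := by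
    rw [Real.negMulLog]
    field_simp
  rw [e]
  exact mul_pos hpos' hε

theorem differentiableAt_negMulLog_comp {f : ℝ → ℝ} {x : ℝ} (hf : DifferentiableAt ℝ f x)
    (h : f x ≠ 0) : DifferentiableAt ℝ (fun y => Real.negMulLog (f y)) x :=
  (Real.differentiableAt_negMulLog_iff.2 h).comp x hf

theorem IsComplementary.exists_pos_hasQuantumCapacity {n e : ℕ}
    {Φ : Mat (Fin (n + 2)) →ₗ[ℂ] Mat (Fin (n + 2))} {Ψ : Mat (Fin (n + 2)) →ₗ[ℂ] Mat (Fin e)}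
    (h : IsComplementary Φ Ψ) {ε : ℝ} (h0 : 0 ≤ ε) (h1 : ε ≤ 1)
    (hlt : entropy (Φ (diagonal fun k => (twoLevel n ε k : ℂ))) <
      entropy (Ψ (diagonal fun k => (twoLevel n ε k : ℂ)))) :
    ∃ Q : ℝ, HasQuantumCapacity Ψ Q ∧ 0 < Q := by
  obtain ⟨Q, hQ, hle⟩ := (h.isCoherentValue_tensorPower_one
    (isState_diagonal (twoLevel_nonneg h0 h1) (sum_twoLevel ε))).exists_hasQuantumCapacity
  exact ⟨Q, hQ, (sub_pos.2 hlt).trans_le hle⟩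

theorem exists_hasQuantumCapacity_depolarizing_complement {n e : ℕ} {p : ℝ} (hp : 0 < p)
    (ht : 0 < 1 - p + p / (n + 2 : ℕ))
    {Ψ : Mat (Fin (n + 2)) →ₗ[ℂ] Mat (Fin e)} (h : IsComplementary (depolarizing (n + 2) p) Ψ) :
    ∃ Q : ℝ, HasQuantumCapacity Ψ Q ∧ 0 < Q := by
  set s := p / (n + 2 : ℕ) with hs
  have hs0 : 0 < s := by positivity
  -- Here `g` is the lower bound for the environment entropy without its singular terms, minus the
  -- exact output entropy. Positivity of `s` and `1 - p + s` keeps every logarithm in it smooth at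
  -- `0`.
  have hev := eventually_pos_add_mul_negMulLog (c := (n + 1 : ℝ)) (s := s)
    (g := fun ε => Real.negMulLog (1 - p + s) + (n + 1) * Real.negMulLog ((1 - ε) * s) -
      (Real.negMulLog ((1 - p) * (1 - ε) + s) + Real.negMulLog ((1 - p) * ε + s) +
        n * Real.negMulLog s))
    (by
      have d1 := differentiableAt_negMulLog_comp (f := fun ε => (1 - ε) * s) (x := 0)
        (by fun_prop) (by simpa using hs0.ne')
      have d2 := differentiableAt_negMulLog_comp (f := fun ε => (1 - p) * (1 - ε) + s) (x := 0)
        (by fun_prop) (by simpa using ht.ne')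
      have d3 := differentiableAt_negMulLog_comp (f := fun ε => (1 - p) * ε + s) (x := 0)
        (by fun_prop) (by simpa using hs0.ne')
      fun_prop)
    (by simp; ring) (by positivity) hs0
  obtain ⟨ε, hε, hmem⟩ := (hev.and (Ioo_mem_nhdsGT one_pos)).exists
  refine h.exists_pos_hasQuantumCapacity hmem.1.le hmem.2.le ?_
  refine lt_of_lt_of_le ?_ (le_entropy_depolarizing_complement hmem.1.le hmem.2.le h)
  rw [entropy_depolarizing_diagonal p (sum_twoLevel ε), sum_negMulLog_twoLevel, ← hs]
  linarith

theorem exists_hasQuantumCapacity_transposeDepolarizing_complement {n e : ℕ} {q : ℝ} (hq : 0 < q)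
    (ht : 0 < 1 - q + q / (n + 2 : ℕ))
    {Ψ : Mat (Fin (n + 2)) →ₗ[ℂ] Mat (Fin e)}
    (h : IsComplementary (transposeDepolarizing (n + 2) q) Ψ) :
    ∃ Q : ℝ, HasQuantumCapacity Ψ Q ∧ 0 < Q := by
  set s := q / (n + 2 : ℕ) with hs
  have hs0 : 0 < s := by positivity
  -- Only the singular term from `(1, 1)` is used, since it is present even for `d = 2`. The `n`
  -- terms in `ε * s` are merely kept nonnegative, which is why `ε < 1/s` is imposed below.
  have hev := eventually_pos_add_mul_negMulLog (c := 1) (s := 1 - q + s)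
    (g := fun ε => Real.negMulLog s + Real.negMulLog ((1 - ε) * (1 - q + s)) +
      n * Real.negMulLog ((1 - ε) * s) -
      (Real.negMulLog ((1 - q) * (1 - ε) + s) + Real.negMulLog ((1 - q) * ε + s) +
        n * Real.negMulLog s))
    (by
      have d1 := differentiableAt_negMulLog_comp (f := fun ε => (1 - ε) * s) (x := 0)
        (by fun_prop) (by simpa using hs0.ne')
      have d2 := differentiableAt_negMulLog_comp (f := fun ε => (1 - q) * (1 - ε) + s) (x := 0)
        (by fun_prop) (by simpa using ht.ne')
      have d3 := differentiableAt_negMulLog_comp (f := fun ε => (1 - q) * ε + s) (x := 0)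
        (by fun_prop) (by simpa using hs0.ne')
      have d4 := differentiableAt_negMulLog_comp (f := fun ε => (1 - ε) * (1 - q + s)) (x := 0)
        (by fun_prop) (by simpa using ht.ne')
      fun_prop)
    (by simp; ring) one_pos ht
  obtain ⟨ε, ⟨hε, hmem⟩, hmem'⟩ := ((hev.and (Ioo_mem_nhdsGT one_pos)).and
    (Ioo_mem_nhdsGT (inv_pos.2 hs0))).exists
  refine h.exists_pos_hasQuantumCapacity hmem.1.le hmem.2.le ?_
  refine lt_of_lt_of_le ?_ (le_entropy_transposeDepolarizing_complement hmem.1.le hmem.2.le h)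
  rw [entropy_transposeDepolarizing_diagonal q (sum_twoLevel ε), sum_negMulLog_twoLevel, ← hs]
  have hpos : 0 ≤ (n : ℝ) * Real.negMulLog (ε * s) :=
    mul_nonneg n.cast_nonneg (Real.negMulLog_nonneg (mul_pos hmem.1 hs0).le
      ((lt_div_iff₀ hs0).1 (by simpa using hmem'.2)).le)
  linarith

end QuantumChannels

theorem theorem4p1 (d : ℕ) (hd : 2 ≤ d) :
    (∀ p ∈ Set.Icc (0 : ℝ) ((d : ℝ) ^ 2 / ((d : ℝ) ^ 2 - 1)), 0 < p →
      ∀ (e : ℕ) (Φc : QuantumChannels.Mat (Fin d) →ₗ[ℂ] QuantumChannels.Mat (Fin e)),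
        QuantumChannels.IsComplementary (QuantumChannels.depolarizing d p) Φc →
          ∃ Q : ℝ, QuantumChannels.HasQuantumCapacity Φc Q ∧ 0 < Q) ∧
    (∀ q ∈ Set.Icc ((d : ℝ) / ((d : ℝ) + 1)) ((d : ℝ) / ((d : ℝ) - 1)),
      q < (d : ℝ) / ((d : ℝ) - 1) →
      ∀ (e : ℕ) (Φc : QuantumChannels.Mat (Fin d) →ₗ[ℂ] QuantumChannels.Mat (Fin e)),
        QuantumChannels.IsComplementary (QuantumChannels.transposeDepolarizing d q) Φc →
          ∃ Q : ℝ, QuantumChannels.HasQuantumCapacity Φc Q ∧ 0 < Q) := by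
  obtain ⟨n, rfl⟩ : ∃ n, d = n + 2 := ⟨d - 2, by omega⟩
  have hD : (2 : ℝ) ≤ ((n + 2 : ℕ) : ℝ) := by exact_mod_cast hd
  -- The bound `d/(d - 1)` is exactly where the eigenvalue `1 - r + r/d` of the output of a basis
  -- state vanishes.
  have ht : ∀ r : ℝ, r < ((n + 2 : ℕ) : ℝ) / (((n + 2 : ℕ) : ℝ) - 1) →
      0 < 1 - r + r / (n + 2 : ℕ) := by
    intro r hr
    generalize ((n + 2 : ℕ) : ℝ) = D at hD hr ⊢
    rw [lt_div_iff₀ (by linarith)] at hr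
    have : 1 - r + r / D = (D - r * (D - 1)) / D := by
      field_simp
      ring
    rw [this]
    exact div_pos (by linarith) (by linarith)
  refine ⟨fun p hp hp0 e Φc h => ?_, fun q hq hq1 e Φc h => ?_⟩
  · refine QuantumChannels.exists_hasQuantumCapacity_depolarizing_complement hp0 (ht p ?_) h
    refine hp.2.trans_lt ?_
    generalize ((n + 2 : ℕ) : ℝ) = D at hD ⊢
    -- Since `d²/(d² - 1) < d/(d - 1)`, the depolarizing range never reaches the degenerate value.
    rw [div_lt_div_iff₀ (by nlinarith) (by linarith)]
    nlinarith
  · refine QuantumChannels.exists_hasQuantumCapacity_transposeDepolarizing_complement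
      (lt_of_lt_of_le ?_ hq.1) (ht q hq1) h
    positivity
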